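/- **Theorem (Switching regret).** There are absolute constants $C>0$ and $k\in\mathbb N$ such that the following holds. Let $d\in\mathbb N$, $G>0$, $T\in\mathbb N_+$, and $u_1,\dots,u_T\in\mathbb R^d$. Consider online convex optimization on $\mathbb R^d$: in round $t$ the player predicts $x_t\in\mathbb R^d$, and an adaptive environment $\mathcal E$ chooses (knowing $x_1,\dots,x_t$) a convex loss $l_t:\mathbb R^d\to\mathbb R$ that is $G$-Lipschitz for the Euclidean norm and reveals a subgradient $g_t\in\partial l_t(x_t)$. Let $\mathrm{Reg}_T(u_{1:T})=\sup_{\mathcal E}\big[\sum_{t=1}^T l_t(x_t)-\sum_{t=1}^T l_t(u_t)\big]$. Then the anytime Haar OLR algorithm defined below, which knows $G$ but neither $T$ nor $u_{1:T}$, satisfies $$\mathrm{Reg}_T(u_{1:T})\le C\,G\log(T+1)+C\,G\left(\|\bar u\|_2\sqrt T+\sqrt{K\bar E}\right)\big(1+\log T+\log(1+M)\big)^k ,$$ where $\bar u=\frac1T\sum_{t=1}^T u_t$, $K=\sum_{t=1}^{T-1}\mathbf 1[u_{t+1}\ne u_t]$, $\bar E=\sum_{t=1}^T\|u_t-\bar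 u\|_2^2$ and $M=\max_{1\le t\le T}\|u_t\|_2$; that is, $\mathrm{Reg}_T(u_{1:T})\le\tilde O\big(\|\bar u\|_2\sqrt T+\sqrt{K\bar E}\big)$. *FreeGrad* with hyperparameter $\varepsilon$ and Lipschitz constant $G$ keeps $s$, the sum of the gradients received so far, and $v=G^2+\sum\|g\|_2^2$ over these gradients, and outputs $$\hat x=-\varepsilon s\cdot\frac{(2v+G\|s\|_2)G^2}{2(v+G\|s\|_2)^2\sqrt v}\exp\!\left(\frac{\|s\|_2^2}{2v+2G\|s\|_2}\right).$$ *Haar OLR with horizon $2^m$* uses $2^m$ scalar features on $t\in\{1,\dots,2^m\}$: the all-one feature and, for $1\le j\le m$, $1\le l\le 2^{m-j}$, the feature $h^{(j,l)}$ equal to $1$ on the first half and $-1$ on the second half of $\{2^j(l-1)+1,\dots,2^jl\}$ and $0$ elsewhere. Each feature $h$ has its own copy of $d$-dimensional FreeGrad with hyperparameter $\varepsilon/2^m$ and Lipschitz constant $G$; in round $t$ the prediction is the sum over the features with $h_t\ne0$ of $h_t\hat x_t$, where $\hat x_t$ is the output of the feature's copy, and each of these copies then receives the surrogate gradient $h_tg_t$.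 *Anytime Haar OLR* runs, for $m=1,2,\dots$ successively, a fresh copy of Haar OLR with horizon $2^m$ and $\varepsilon=1$ for $2^m$ rounds. -/

import Mathlib

noncomputable section

open scoped NNReal

/-- The decision space `ℝ^d` with the Euclidean norm. -/
abbrev Vec (d : ℕ) : Type := EuclideanSpace ℝ (Fin d)

/-- A deterministic online algorithm with gradient feedback: it maps the chronological list
`[g_1, …, g_{t-1}]` of the gradients observed so far to the prediction `x_t`. -/
abbrev OnlineAlgorithm (d : ℕ) : Type := List (Vec d) → Vec d

/-! ### The game -/

/-- An adaptive environment. With `past = [x_1, …, x_{t-1}]` and `x = x_t`, the function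
`loss past x` is the convex `G`-Lipschitz loss `l_t` of round `t`, and `grad past x` is the
subgradient `g_t ∈ ∂ l_t(x_t)` that is revealed to the player. -/
structure Environment (d : ℕ) (G : ℝ≥0) where
  loss : List (Vec d) → Vec d → Vec d → ℝ
  grad : List (Vec d) → Vec d → Vec d
  convex : ∀ past x, ConvexOn ℝ Set.univ (loss past x)
  lipschitz : ∀ past x, LipschitzWith G (loss past x)
  subgradient : ∀ past x y, loss past x x + inner ℝ (grad past x) (y - x) ≤ loss past x y

/-- The first `t` rounds of the game: the lists `[x_1, …, x_t]` of predictions and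
`[g_1, …, g_t]` of revealed gradients. -/
def play {d : ℕ} {G : ℝ≥0} (A : OnlineAlgorithm d) (env : Environment d G) :
    ℕ → List (Vec d) × List (Vec d)
  | 0 => ([], [])
  | t + 1 =>
    let xs := (play A env t).1
    let gs := (play A env t).2
    (xs ++ [A gs], gs ++ [env.grad xs (A gs)])

/-- The prediction `x_t` of round `t = 1, 2, …`. -/
def prediction {d : ℕ} {G : ℝ≥0} (A : OnlineAlgorithm d) (env : Environment d G) (t : ℕ) : Vec d :=
  A (play A env (t - 1)).2

/-- The loss function `l_t` of round `t = 1, 2, …`. -/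
def roundLoss {d : ℕ} {G : ℝ≥0} (A : OnlineAlgorithm d) (env : Environment d G) (t : ℕ) :
    Vec d → ℝ :=
  env.loss (play A env (t - 1)).1 (prediction A env t)

/-- The unconstrained dynamic regret
`Reg_T(u_{1:T}) = sup_env [∑_{t=1}^T l_t(x_t) - ∑_{t=1}^T l_t(u_t)]`, as an extended real. -/
def dynamicRegret {d : ℕ} (A : OnlineAlgorithm d) (G : ℝ≥0) (T : ℕ) (u : ℕ → Vec d) : EReal :=
  ⨆ env : Environment d G,
    ((∑ t ∈ Finset.Icc 1 T, roundLoss A env t (prediction A env t)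
      - ∑ t ∈ Finset.Icc 1 T, roundLoss A env t (u t) : ℝ) : EReal)

/-! ### The algorithm -/

/-- The FreeGrad prediction in dimension `d` with hyperparameter `ε` and Lipschitz constant `G`, as
a function of the gradient sum `s` and the variance counter `v`. -/
def freeGradPrediction {d : ℕ} (ε G : ℝ) (s : Vec d) (v : ℝ) : Vec d :=
  (-(ε * ((2 * v + G * ‖s‖) * G ^ 2 / (2 * (v + G * ‖s‖) ^ 2 * √v))
      * Real.exp (‖s‖ ^ 2 / (2 * v + 2 * G * ‖s‖)))) • s

/-- FreeGrad: its state after observing the gradients in `gs` is `s = ∑ g` and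
`v = G ^ 2 + ∑ ‖g‖ ^ 2`. -/
def freeGrad {d : ℕ} (ε G : ℝ) : OnlineAlgorithm d := fun gs =>
  freeGradPrediction ε G gs.sum (G ^ 2 + (gs.map fun g => ‖g‖ ^ 2).sum)

/-- The Haar feature `h^{(j,l)}_t` of scale `j ≥ 1` and location `l ≥ 1` at time `t ≥ 1`. -/
def haarFeature (j l t : ℕ) : ℝ :=
  if t ∈ Finset.Icc (2 ^ j * (l - 1) + 1) (2 ^ j * (l - 1) + 2 ^ (j - 1)) then 1
  else if t ∈ Finset.Icc (2 ^ j * (l - 1) + 2 ^ (j - 1) + 1) (2 ^ j * l) then -1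
  else 0

/-- The surrogate gradients `h_i • g_i` that are sent to the FreeGrad copy of a scalar feature
`h = (h_1, h_2, …)`, one for each past round `i` with `h_i ≠ 0`. -/
def surrogateGradients {d : ℕ} (h : ℕ → ℝ) (gs : List (Vec d)) : List (Vec d) :=
  (gs.zipIdx 1).filterMap fun p => if h p.2 = 0 then none else some (h p.2 • p.1)

/-- The contribution `w_t = h_t • x̂_t` of the feature `h` in round `t = gs.length + 1`, where
`x̂_t` is the output of the FreeGrad copy of this feature (irrelevant when `h_t = 0`). -/
def featureLearner {d : ℕ} (ε G : ℝ) (h : ℕ → ℝ) : OnlineAlgorithm d := fun gs =>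
  h (gs.length + 1) • freeGrad ε G (surrogateGradients h gs)

/-- Haar OLR for the known horizon `2 ^ m`: the dictionary consists of the all-one feature and the
Haar features of scales `j ∈ [1 : m]` and locations `l ∈ [1 : 2 ^ (m - j)]`, so it has
`N = 2 ^ m` features; each of them runs `d`-dimensional FreeGrad with hyperparameter `ε / N`. -/
def haarOLR {d : ℕ} (m : ℕ) (ε G : ℝ) : OnlineAlgorithm d := fun gs =>
  featureLearner (ε / 2 ^ m) G (fun _ => 1) gs
    + ∑ j ∈ Finset.Icc 1 m, ∑ l ∈ Finset.Icc 1 (2 ^ (m - j)),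
        featureLearner (ε / 2 ^ m) G (haarFeature j l) gs

/-- Anytime Haar OLR: for `m = 1, 2, …` a fresh copy of `haarOLR m` with hyperparameter `1` is run
for `2 ^ m` rounds. The blocks before block `m` last `2 + 4 + ⋯ + 2 ^ (m - 1) = 2 ^ m - 2` rounds,
so the block of the round that follows `p` past rounds is the `m` with
`2 ^ m ≤ p + 2 < 2 ^ (m + 1)`. -/
def anytimeHaarOLR {d : ℕ} (G : ℝ) : OnlineAlgorithm d := fun gs =>
  let m := Nat.log 2 (gs.length + 2)
  haarOLR m 1 G (gs.drop (2 ^ m - 2))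

/-! ### Statistics of the comparator sequence `u_1, …, u_T` -/

/-- Comparator average `ū`. -/
def comparatorAverage {d : ℕ} (T : ℕ) (u : ℕ → Vec d) : Vec d :=
  (T : ℝ)⁻¹ • ∑ t ∈ Finset.Icc 1 T, u t

open Classical in
/-- Number of switches `K`. -/
def numSwitches {d : ℕ} (T : ℕ) (u : ℕ → Vec d) : ℕ :=
  ∑ t ∈ Finset.Icc 1 (T - 1), if u (t + 1) ≠ u t then 1 else 0

/-- Second order variability `Ē`. -/
def secondOrderVariability {d : ℕ} (T : ℕ) (u : ℕ → Vec d) : ℝ :=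
  ∑ t ∈ Finset.Icc 1 T, ‖u t - comparatorAverage T u‖ ^ 2

/-- Maximum range `M = max_t ‖u_t‖`. -/
def maxRange {d : ℕ} (T : ℕ) (u : ℕ → Vec d) : ℝ≥0 :=
  (Finset.Icc 1 T).sup fun t => ‖u t‖₊

end

/-! FreeGrad plays the negative gradient of the potential `ε G exp (‖s‖² / (2 (v + G ‖s‖))) G / √v`.
If this potential increases in a round by at most the negative loss of the player, then the regret
against a fixed `w` is at most `ε G + ‖s‖ ‖w‖ - potential`, which is of order `ε G + G ‖w‖ √N` up to
logarithms when `∑ ‖g‖ ≤ N G`. The one-step inequality reduces to one dimension: splitting the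
gradient into a part along `s` and a part orthogonal to `s`, the former is controlled by tangents of
the convex function `y² / (2 (w + y))`, and the latter can only decrease the potential.

The Haar features of a block form an orthogonal basis, and the copy of FreeGrad that belongs to a
feature competes with the corresponding Haar coefficient of the comparator sequence. A coefficient
vanishes unless the comparator switches inside the support of its feature, so on each scale at most
as many coefficients survive as there are switches. The Cauchy–Schwarz inequality on each scale then
gives `√(K Ē)`, the all-one feature gives `‖ū‖ √T`, and the number of scales and the number of
blocks are logarithmic in `T`. -/

noncomputable section

open Finset
open scoped NNReal

/-! ### The FreeGrad potential -/

theorem sub_sq_div_two_le_log_one_add {z : ℝ} (hz : 0 ≤ z) :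
    z - z ^ 2 / 2 ≤ Real.log (1 + z) := by
  refine le_trans ?_ (Real.le_log_one_add_of_nonneg hz)
  rw [le_div_iff₀ (by linarith)]
  nlinarith [pow_nonneg hz 3]

theorem sub_sq_div_le_log_one_add {z : ℝ} (hz : -1 < z) (hz0 : z ≤ 0) :
    z - z ^ 2 / (2 * (1 + z)) ≤ Real.log (1 + z) := by
  have hpos : 0 < 1 + z := by linarith
  have hlog : ((1 + z) - (1 + z)⁻¹) / 2 ≤ Real.log (1 + z) := by
    rw [← Real.sinh_log hpos]
    exact Real.sinh_le_self_iff.2 (Real.log_nonpos hpos.le (by linarith))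
  refine le_of_eq_of_le ?_ hlog
  field_simp
  ring

theorem mul_sub_sq_le_log_one_add {a c : ℝ} (ha : 0 ≤ a) (ha1 : a ≤ 1) (hc : -1 ≤ c) :
    c * (a * (2 - a) / 2) - c ^ 2 * a ^ 2 / 2 ≤ Real.log (1 + c * (a * (2 - a) / 2)) := by
  set L := a * (2 - a) / 2 with hL
  have hL0 : 0 ≤ L := by nlinarith
  have hL1 : L ≤ 1 / 2 := by nlinarith [sq_nonneg (1 - a)]
  have hLa : L ^ 2 ≤ a ^ 2 * (1 - L) := by nlinarith [sq_nonneg a, mul_nonneg ha hL0]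
  rcases le_total 0 c with h0 | h0
  · have hsq : (c * L) ^ 2 ≤ c ^ 2 * a ^ 2 := by
      rw [mul_pow]
      gcongr
      nlinarith
    linarith [sub_sq_div_two_le_log_one_add (mul_nonneg h0 hL0)]
  · have hcL : -L ≤ c * L := by nlinarith
    have hsq : (c * L) ^ 2 / (2 * (1 + c * L)) ≤ c ^ 2 * a ^ 2 / 2 := by
      rw [div_le_div_iff₀ (by linarith) two_pos, mul_pow]
      nlinarith [mul_le_mul_of_nonneg_left hLa (sq_nonneg c),
        mul_nonneg (sq_nonneg c) (sq_nonneg a)]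
    linarith [sub_sq_div_le_log_one_add (z := c * L) (by linarith)
      (mul_nonpos_of_nonpos_of_nonneg h0 hL0)]

/-- The logarithm of the FreeGrad potential for `ε = G = 1`, as a function of the norm `x` of the
gradient sum and of the variance counter `v`. -/
def logPotential (x v : ℝ) : ℝ := x ^ 2 / (2 * (v + x)) - Real.log v / 2

/-- The derivative of `logPotential x v` in `x`, which is the factor of the FreeGrad prediction in
front of the potential. -/
def logPotentialSlope (x v : ℝ) : ℝ := x * (2 * v + x) / (2 * (v + x) ^ 2)

theorem logPotentialSlope_eq {x v : ℝ} (h : v + x ≠ 0) :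
    logPotentialSlope x v = x / (v + x) * (2 - x / (v + x)) / 2 := by
  rw [logPotentialSlope]
  field_simp
  ring

/-- The tangent plane of the convex function `y ^ 2 / (2 * (w + y))` at the points with
`y / (w + y) = a`; the last term is its distance from the graph. -/
theorem sq_div_eq_tangent_add {y w : ℝ} (h : w + y ≠ 0) (a : ℝ) :
    y ^ 2 / (2 * (w + y)) =
      y * (a * (2 - a) / 2) - w * (a ^ 2 / 2) + (y - a * (w + y)) ^ 2 / (2 * (w + y)) := by
  field_simp
  ring

theorem sq_div_le_tangent_of_nonneg_add {v x c : ℝ} (hv : 0 < v) (hx : 0 ≤ x) (hc : |c| ≤ 1)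
    (hxc : 0 ≤ x + c) :
    (x + c) ^ 2 / (2 * (v + c ^ 2 + (x + c))) ≤
      x ^ 2 / (2 * (v + x)) + c * logPotentialSlope x v - c ^ 2 * (x / (v + x)) ^ 2 / 2
        + c ^ 2 / (2 * v + c ^ 2) := by
  obtain ⟨hc0, hc1⟩ := abs_le.1 hc
  have hp : 0 < v + x := by linarith
  have hD : 0 < v + c ^ 2 + (x + c) := by positivity
  rw [logPotentialSlope_eq hp.ne']
  set a := x / (v + x)
  have hap : a * (v + x) = x := div_mul_cancel₀ _ hp.ne'
  have hdist : x + c - a * (v + c ^ 2 + (x + c)) = c * (1 - a * (1 + c)) := by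
    linear_combination -hap
  have hshrink : (1 - a * (1 + c)) ^ 2 ≤ 1 := by
    rw [sq_le_one_iff_abs_le_one, abs_le]
    constructor <;> nlinarith
  have hrem : (c * (1 - a * (1 + c))) ^ 2 / (2 * (v + c ^ 2 + (x + c)))
      ≤ c ^ 2 / (2 * v + c ^ 2) := by
    rw [mul_pow]
    exact div_le_div₀ (sq_nonneg c) (mul_le_of_le_one_right (sq_nonneg c) hshrink)
      (by positivity) (by nlinarith [sq_nonneg c])
  have hend := sq_div_eq_tangent_add hD.ne' a
  have hstart := sq_div_eq_tangent_add hp.ne' a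
  rw [hdist] at hend
  rw [hap, sub_self, zero_pow two_ne_zero, zero_div] at hstart
  linarith

theorem sq_mul_sub_div_le {v x b : ℝ} (hv : 1 ≤ v) (hx : 0 ≤ x) (hb : b ≤ 1) (hxb : x ≤ b) :
    b ^ 2 * (b ^ 2 - 2 * x) / (2 * v + b ^ 2) ≤
      (b - x) ^ 2 * (b ^ 2 + b - 2 * x) / (v + b ^ 2 + (b - x)) := by
  have hD : 0 < v + b ^ 2 + (b - x) := by nlinarith [sq_nonneg b]
  have hq : 0 < 2 * v + b ^ 2 := by positivity
  rcases le_or_gt (b ^ 2) (2 * x) with h | h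
  · rcases le_or_gt (2 * x) (b ^ 2 + b) with h' | h'
    · have hleft : b ^ 2 * (b ^ 2 - 2 * x) / (2 * v + b ^ 2) ≤ 0 :=
        div_nonpos_of_nonpos_of_nonneg
          (mul_nonpos_of_nonneg_of_nonpos (sq_nonneg b) (by linarith)) hq.le
      have hright : 0 ≤ (b - x) ^ 2 * (b ^ 2 + b - 2 * x) / (v + b ^ 2 + (b - x)) :=
        div_nonneg (mul_nonneg (sq_nonneg _) (by linarith)) hD.le
      exact hleft.trans hright
    · have hnum : (b - x) ^ 2 * (2 * x - b ^ 2 - b) ≤ b ^ 2 / 4 * (2 * x - b ^ 2) :=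
        mul_le_mul (by nlinarith) (by linarith) (by linarith) (by positivity)
      have hcross : (b - x) ^ 2 * (2 * x - b ^ 2 - b) * (2 * v + b ^ 2) ≤
          b ^ 2 / 4 * (2 * x - b ^ 2) * (4 * (v + b ^ 2 + (b - x))) :=
        mul_le_mul hnum (by nlinarith) hq.le (mul_nonneg (by positivity) (by linarith))
      rw [div_le_div_iff₀ hq hD]
      linarith
  · have hnum : b ^ 2 - 2 * x ≤ (b - x) ^ 2 := by nlinarith
    have hden : b ^ 2 * (v + b ^ 2 + (b - x)) ≤ (b ^ 2 + b - 2 * x) * (2 * v + b ^ 2) :=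
      mul_le_mul (by nlinarith) (by linarith) hD.le (by linarith)
    rw [div_le_div_iff₀ hq hD]
    linarith [mul_le_mul hnum hden (by positivity) (sq_nonneg _)]

theorem sq_div_le_tangent_of_add_nonpos {v x b : ℝ} (hv : 1 ≤ v) (hx : 0 ≤ x) (hb : b ≤ 1)
    (hxb : x ≤ b) :
    (b - x) ^ 2 / (2 * (v + b ^ 2 + (b - x))) ≤
      x ^ 2 / (2 * (v + x)) - b * logPotentialSlope x v - b ^ 2 * (x / (v + x)) ^ 2 / 2
        + b ^ 2 / (2 * v + b ^ 2) := by
  have hb0 : 0 ≤ b := hx.trans hxb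
  have hp : 0 < v + x := by linarith
  have hD : v + b ^ 2 + (b - x) ≠ 0 := by nlinarith [sq_nonneg b]
  have hgap : x ^ 2 / (2 * (v + x)) - b * logPotentialSlope x v - b ^ 2 * (x / (v + x)) ^ 2 / 2
      + b ^ 2 / (2 * v + b ^ 2) - (b - x) ^ 2 / (2 * (v + b ^ 2 + (b - x))) =
      (2 * (v + x))⁻¹ * ((b - x) ^ 2 * (b ^ 2 + b - 2 * x) / (v + b ^ 2 + (b - x))
        - b ^ 2 * (b ^ 2 - 2 * x) / (2 * v + b ^ 2) + b * (1 - b) * x ^ 2 / (v + x)) := by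
    rw [logPotentialSlope]
    field_simp
    ring
  have hlast : 0 ≤ b * (1 - b) * x ^ 2 / (v + x) :=
    div_nonneg (mul_nonneg (mul_nonneg hb0 (by linarith)) (sq_nonneg x)) hp.le
  rw [← sub_nonneg, hgap]
  exact mul_nonneg (by positivity)
    (add_nonneg (sub_nonneg.2 (sq_mul_sub_div_le hv hx hb hxb)) hlast)

theorem logPotential_abs_add_le {v x c : ℝ} (hv : 1 ≤ v) (hx : 0 ≤ x) (hc : |c| ≤ 1) :
    logPotential |x + c| (v + c ^ 2) ≤
      logPotential x v + Real.log (1 + c * logPotentialSlope x v) := by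
  have hp : 0 < v + x := by linarith
  have htangent : |x + c| ^ 2 / (2 * (v + c ^ 2 + |x + c|)) ≤
      x ^ 2 / (2 * (v + x)) + c * logPotentialSlope x v - c ^ 2 * (x / (v + x)) ^ 2 / 2
        + c ^ 2 / (2 * v + c ^ 2) := by
    rcases le_total 0 (x + c) with h | h
    · rw [abs_of_nonneg h]
      exact sq_div_le_tangent_of_nonneg_add (by linarith) hx hc h
    · have hneg := sq_div_le_tangent_of_add_nonpos (b := -c) hv hx (by linarith [neg_abs_le c])
        (by linarith)
      rw [abs_of_nonpos h, neg_add_rev, ← sub_eq_add_neg]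
      simpa only [neg_sq, neg_mul, sub_neg_eq_add] using hneg
  have hcurv : c * logPotentialSlope x v - c ^ 2 * (x / (v + x)) ^ 2 / 2 ≤
      Real.log (1 + c * logPotentialSlope x v) := by
    rw [logPotentialSlope_eq hp.ne']
    exact mul_sub_sq_le_log_one_add (by positivity) ((div_le_one hp).2 (by linarith))
      (abs_le.1 hc).1
  have hlog : 2 * (c ^ 2 / (2 * v + c ^ 2)) ≤ Real.log (v + c ^ 2) - Real.log v := by
    rw [← Real.log_div (by positivity) (by positivity), add_div, div_self (by positivity)]
    refine le_of_eq_of_le ?_ (Real.le_log_one_add_of_nonneg (by positivity))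
    field_simp
    ring
  rw [logPotential, logPotential]
  linarith

theorem logPotential_le_of_sq_eq_add {v x q r : ℝ} (hv : 0 < v) (hx : 0 ≤ x) (hr : 0 ≤ r)
    (hq : 0 ≤ q) (h : r ^ 2 = x ^ 2 + q) : logPotential r (v + q) ≤ logPotential x v := by
  have hxr : x ≤ r := le_of_sq_le_sq (by linarith) hr
  have hfrac : r ^ 2 / (2 * (v + q + r)) ≤ x ^ 2 / (2 * (v + x)) + q / (v + q) / 2 := by
    rw [h, add_div, div_div q, mul_comm (v + q) 2]
    exact add_le_add
      (div_le_div_of_nonneg_left (sq_nonneg x) (by positivity) (by linarith))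
      (div_le_div_of_nonneg_left hq (by positivity) (by linarith))
  have hlog : q / (v + q) ≤ Real.log (v + q) - Real.log v := by
    rw [← Real.log_div (by positivity) hv.ne']
    refine le_of_eq_of_le ?_ (Real.one_sub_inv_le_log_of_pos (by positivity))
    field_simp
    ring
  rw [logPotential, logPotential]
  linarith

theorem logPotential_step {v x c q r : ℝ} (hv : 1 ≤ v) (hx : 0 ≤ x) (hr : 0 ≤ r)
    (hcq : c ^ 2 ≤ q) (hq : q ≤ 1) (h : r ^ 2 = x ^ 2 + 2 * (c * x) + q) :
    logPotential r (v + q) ≤ logPotential x v + Real.log (1 + c * logPotentialSlope x v) := by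
  have horth := logPotential_le_of_sq_eq_add (v := v + c ^ 2) (x := |x + c|) (q := q - c ^ 2)
    (by positivity) (abs_nonneg _) hr (by linarith) (by rw [h, sq_abs]; ring)
  rw [add_add_sub_cancel] at horth
  exact horth.trans
    (logPotential_abs_add_le hv hx ((sq_le_one_iff_abs_le_one c).1 (hcq.trans hq)))

theorem exp_logPotential_step {v x c q r : ℝ} (hv : 1 ≤ v) (hx : 0 ≤ x) (hr : 0 ≤ r)
    (hcq : c ^ 2 ≤ q) (hq : q ≤ 1) (h : r ^ 2 = x ^ 2 + 2 * (c * x) + q) :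
    Real.exp (logPotential r (v + q)) ≤
      Real.exp (logPotential x v) * (1 + c * logPotentialSlope x v) := by
  have hc := (abs_le.1 ((sq_le_one_iff_abs_le_one c).1 (hcq.trans hq))).1
  have hslope0 : 0 ≤ logPotentialSlope x v := by
    unfold logPotentialSlope
    positivity
  have hslope1 : logPotentialSlope x v < 1 := by
    rw [logPotentialSlope, div_lt_one (by positivity)]
    nlinarith
  have hpos : 0 < 1 + c * logPotentialSlope x v := by nlinarith
  rw [← Real.exp_log hpos, ← Real.exp_add]
  exact Real.exp_le_exp.2 (logPotential_step hv hx hr hcq hq h)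

theorem exp_logPotential {v : ℝ} (x : ℝ) (hv : 0 < v) :
    Real.exp (logPotential x v) = Real.exp (x ^ 2 / (2 * (v + x))) / √v := by
  rw [logPotential, Real.exp_sub, Real.sqrt_eq_rpow, Real.rpow_def_of_pos hv, mul_one_div]

theorem mul_sub_exp_logPotential_le {x y W ε l : ℝ} (hy : 0 < y) (hW : 0 ≤ W) (hε : 0 ≤ ε)
    (hl : 0 ≤ l) (h : x * √y * W ≤ ε * Real.exp l) :
    x * W - ε * Real.exp (logPotential x y) ≤ W * (√(2 * y * l) + 2 * l) := by
  rcases le_total x (√(2 * y * l) + 2 * l) with hx | hx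
  · nlinarith [mul_nonneg hε (Real.exp_pos (logPotential x y)).le]
  · have hsqrt := Real.sqrt_nonneg (2 * y * l)
    have hexponent : l ≤ x ^ 2 / (2 * (y + x)) := by
      rw [le_div_iff₀ (by linarith)]
      nlinarith [Real.sq_sqrt (show 0 ≤ 2 * y * l by positivity)]
    have hpot : x * W ≤ ε * Real.exp (logPotential x y) := by
      rw [exp_logPotential x hy, ← mul_div_assoc, le_div_iff₀ (Real.sqrt_pos.2 hy), mul_right_comm]
      exact h.trans (mul_le_mul_of_nonneg_left (Real.exp_le_exp.2 hexponent) hε)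
    linarith [mul_nonneg hW (by positivity : 0 ≤ √(2 * y * l) + 2 * l)]

/-! ### Regret of FreeGrad -/

section FreeGrad

variable {d : ℕ}

theorem exists_inner_eq_mul_norm {E : Type*} [NormedAddCommGroup E] [InnerProductSpace ℝ E]
    (x y : E) : ∃ c : ℝ, inner ℝ x y = c * ‖y‖ ∧ |c| ≤ ‖x‖ := by
  rcases eq_or_ne y 0 with rfl | hy
  · exact ⟨0, by simp, by simp⟩
  · have hy' : 0 < ‖y‖ := norm_pos_iff.2 hy
    refine ⟨inner ℝ x y / ‖y‖, (div_mul_cancel₀ _ hy'.ne').symm, ?_⟩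
    rw [abs_div, abs_norm, div_le_iff₀ hy']
    exact abs_real_inner_le_norm x y

/-- The potential of FreeGrad, whose negative gradient in `s` is the FreeGrad prediction. -/
def freeGradPotential (ε G : ℝ) (s : Vec d) (v : ℝ) : ℝ :=
  ε * G * Real.exp (logPotential (‖s‖ / G) (v / G ^ 2))

theorem inner_freeGradPrediction {ε G v c : ℝ} (hG : 0 < G) (hv : 0 < v) {s g : Vec d}
    (hc : inner ℝ g s = c * ‖s‖) :
    inner ℝ g (freeGradPrediction ε G s v) =
      -(freeGradPotential ε G s v * (c / G * logPotentialSlope (‖s‖ / G) (v / G ^ 2))) := by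
  have hexponent : (‖s‖ / G) ^ 2 / (2 * (v / G ^ 2 + ‖s‖ / G)) =
      ‖s‖ ^ 2 / (2 * v + 2 * G * ‖s‖) := by
    field_simp
  have hsqrt : √v ≠ 0 := (Real.sqrt_pos.2 hv).ne'
  rw [freeGradPotential, exp_logPotential _ (by positivity), hexponent, freeGradPrediction,
    real_inner_smul_right, hc, Real.sqrt_div hv.le, Real.sqrt_sq hG.le, logPotentialSlope]
  field_simp

theorem freeGradPotential_step {ε G v : ℝ} (hε : 0 ≤ ε) (hG : 0 < G) (s : Vec d) {g : Vec d}
    (hg : ‖g‖ ≤ G) (hv : G ^ 2 ≤ v) :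
    inner ℝ g (freeGradPrediction ε G s v) + freeGradPotential ε G (s + g) (v + ‖g‖ ^ 2) ≤
      freeGradPotential ε G s v := by
  obtain ⟨c, hc, hcg⟩ := exists_inner_eq_mul_norm g s
  have hnorm : (‖s + g‖ / G) ^ 2 =
      (‖s‖ / G) ^ 2 + 2 * (c / G * (‖s‖ / G)) + ‖g‖ ^ 2 / G ^ 2 := by
    rw [div_pow, norm_add_sq_real, real_inner_comm, hc]
    ring
  have hc2 : (c / G) ^ 2 ≤ ‖g‖ ^ 2 / G ^ 2 := by
    rw [div_pow, ← sq_abs c]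
    gcongr
  have hg1 : ‖g‖ ^ 2 / G ^ 2 ≤ 1 := by
    rw [div_le_one (by positivity)]
    gcongr
  have hstep := mul_le_mul_of_nonneg_left
    (exp_logPotential_step ((one_le_div (by positivity)).2 hv) (by positivity) (by positivity)
      hc2 hg1 hnorm) (mul_nonneg hε hG.le)
  rw [inner_freeGradPrediction hG ((pow_pos hG 2).trans_le hv) hc, freeGradPotential,
    freeGradPotential, add_div]
  linarith

/-- The regret of the algorithm `A` against the comparators `w 0, …, w (n - 1)` when the losses of
the rounds are the linear functions with gradients `g 0, …, g (n - 1)`. -/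
def linearRegret (A : OnlineAlgorithm d) (g : ℕ → Vec d) (n : ℕ) (w : ℕ → Vec d) : ℝ :=
  ∑ i ∈ range n, inner ℝ (g i) (A ((List.range i).map g) - w i)

theorem linearRegret_congr {A : OnlineAlgorithm d} {g : ℕ → Vec d} {n : ℕ} {w w' : ℕ → Vec d}
    (h : ∀ i < n, w i = w' i) : linearRegret A g n w = linearRegret A g n w' :=
  sum_congr rfl fun i hi => by rw [h i (mem_range.1 hi)]

theorem linearRegret_add (A B : OnlineAlgorithm d) (g : ℕ → Vec d) (n : ℕ) (w z : ℕ → Vec d) :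
    linearRegret (A + B) g n (w + z) = linearRegret A g n w + linearRegret B g n z := by
  simp only [linearRegret, Pi.add_apply, add_sub_add_comm, inner_add_right, sum_add_distrib]

theorem linearRegret_sum {ι : Type*} (s : Finset ι) (A : ι → OnlineAlgorithm d) (g : ℕ → Vec d)
    (n : ℕ) (w : ι → ℕ → Vec d) :
    linearRegret (∑ k ∈ s, A k) g n (∑ k ∈ s, w k) = ∑ k ∈ s, linearRegret (A k) g n (w k) := by
  simp only [linearRegret, Finset.sum_apply, ← sum_sub_distrib, inner_sum]
  exact sum_comm

theorem sum_inner_freeGrad_add_potential_le {ε G : ℝ} (hε : 0 ≤ ε) (hG : 0 < G) {g : ℕ → Vec d}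
    (hg : ∀ i, ‖g i‖ ≤ G) (n : ℕ) :
    ∑ i ∈ range n, inner ℝ (g i) (freeGrad ε G ((List.range i).map g)) +
      freeGradPotential ε G (∑ i ∈ range n, g i) (G ^ 2 + ∑ i ∈ range n, ‖g i‖ ^ 2) ≤ ε * G := by
  induction n with
  | zero => simp [freeGradPotential, logPotential, hG.ne']
  | succ n ih =>
    refine le_trans ?_ ih
    have hstate : freeGrad ε G ((List.range n).map g) =
        freeGradPrediction ε G (∑ i ∈ range n, g i) (G ^ 2 + ∑ i ∈ range n, ‖g i‖ ^ 2) := by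
      rw [freeGrad, List.map_map]
      rfl
    have hstep := freeGradPotential_step hε hG (∑ i ∈ range n, g i) (hg n)
      (le_add_of_nonneg_right (sum_nonneg (s := range n) fun i _ => sq_nonneg ‖g i‖))
    rw [sum_range_succ, sum_range_succ, sum_range_succ, ← add_assoc (G ^ 2), hstate]
    linarith

theorem linearRegret_freeGrad_le_potential {ε G : ℝ} (hε : 0 ≤ ε) (hG : 0 < G) {g : ℕ → Vec d}
    (hg : ∀ i, ‖g i‖ ≤ G) (n : ℕ) (w : Vec d) :
    linearRegret (freeGrad ε G) g n (fun _ => w) ≤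
      ε * G + (‖∑ i ∈ range n, g i‖ * ‖w‖ -
        freeGradPotential ε G (∑ i ∈ range n, g i) (G ^ 2 + ∑ i ∈ range n, ‖g i‖ ^ 2)) := by
  have hpot := sum_inner_freeGrad_add_potential_le hε hG hg n
  have hinner := (abs_le.1 (abs_real_inner_le_norm (∑ i ∈ range n, g i) w)).1
  simp only [linearRegret, inner_sub_right, sum_sub_distrib, ← sum_inner]
  linarith

theorem sqrt_add_le_mul_sqrt {y l N : ℝ} (hl : 0 ≤ l) (hN : 1 ≤ N) (hy : y ≤ 2 * N) :
    √(2 * y * l) + 2 * l ≤ 4 * (1 + l) * √N := by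
  have hsqrt : √(2 * y * l) ≤ 2 * (1 + l) * √N := by
    rw [Real.sqrt_le_left (by positivity), mul_pow, Real.sq_sqrt (by linarith)]
    nlinarith [mul_le_mul_of_nonneg_right hy hl, mul_nonneg (sq_nonneg l) (by linarith : 0 ≤ N)]
  nlinarith [Real.one_le_sqrt.2 hN]

theorem norm_mul_sub_freeGradPotential_le {ε G N l v W : ℝ} (hε : 0 ≤ ε) (hG : 0 < G)
    (hN : 1 ≤ N) (hl : 0 ≤ l) {s : Vec d} (hs : ‖s‖ ≤ N * G) (hv : 0 < v)
    (hvN : v ≤ 2 * N * G ^ 2) (hW : 0 ≤ W) (hWl : 2 * N ^ 2 * W ≤ ε * Real.exp l) :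
    ‖s‖ * W - freeGradPotential ε G s v ≤ 4 * G * (1 + l) * (W * √N) := by
  have hx : ‖s‖ / G ≤ N := (div_le_iff₀ hG).2 hs
  have hy : v / G ^ 2 ≤ 2 * N := (div_le_iff₀ (by positivity)).2 hvN
  have hsqrt : √(v / G ^ 2) ≤ 2 * N := by
    rw [Real.sqrt_le_left (by linarith)]
    nlinarith
  have hlarge : ‖s‖ / G * √(v / G ^ 2) * W ≤ ε * Real.exp l :=
    calc ‖s‖ / G * √(v / G ^ 2) * W ≤ N * (2 * N) * W := by gcongr
      _ = 2 * N ^ 2 * W := by ring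
      _ ≤ ε * Real.exp l := hWl
  calc ‖s‖ * W - freeGradPotential ε G s v =
        G * (‖s‖ / G * W - ε * Real.exp (logPotential (‖s‖ / G) (v / G ^ 2))) := by
        rw [freeGradPotential]
        field_simp
    _ ≤ G * (W * (√(2 * (v / G ^ 2) * l) + 2 * l)) := by
        gcongr
        exact mul_sub_exp_logPotential_le (by positivity) hW hε hl hlarge
    _ ≤ G * (W * (4 * (1 + l) * √N)) := by
        gcongr
        exact sqrt_add_le_mul_sqrt hl hN hy
    _ = 4 * G * (1 + l) * (W * √N) := by ring

theorem linearRegret_freeGrad_le {ε G N l : ℝ} (hε : 0 ≤ ε) (hG : 0 < G) (hN : 1 ≤ N)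
    (hl : 0 ≤ l) {g : ℕ → Vec d} (hg : ∀ i, ‖g i‖ ≤ G) {n : ℕ}
    (hsum : ∑ i ∈ range n, ‖g i‖ ≤ N * G) {w : Vec d} (hw : 2 * N ^ 2 * ‖w‖ ≤ ε * Real.exp l) :
    linearRegret (freeGrad ε G) g n (fun _ => w) ≤ ε * G + 4 * G * (1 + l) * (‖w‖ * √N) := by
  have henergy : ∑ i ∈ range n, ‖g i‖ ^ 2 ≤ N * G ^ 2 :=
    calc ∑ i ∈ range n, ‖g i‖ ^ 2 ≤ ∑ i ∈ range n, ‖g i‖ * G :=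
          sum_le_sum fun i _ => by
            rw [sq]
            exact mul_le_mul_of_nonneg_left (hg i) (norm_nonneg _)
      _ = (∑ i ∈ range n, ‖g i‖) * G := (sum_mul _ _ _).symm
      _ ≤ N * G * G := mul_le_mul_of_nonneg_right hsum hG.le
      _ = N * G ^ 2 := by ring
  refine (linearRegret_freeGrad_le_potential hε hG hg n w).trans (add_le_add_right ?_ _)
  exact norm_mul_sub_freeGradPotential_le hε hG hN hl ((norm_sum_le _ _).trans hsum)
    (by positivity) (by nlinarith [sq_nonneg G]) (norm_nonneg w) hw

/-! ### Regret of a single feature -/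

theorem surrogateGradients_append_singleton (h : ℕ → ℝ) (gs : List (Vec d)) (g : Vec d) :
    surrogateGradients h (gs ++ [g]) = surrogateGradients h gs ++
      if h (gs.length + 1) = 0 then [] else [h (gs.length + 1) • g] := by
  rw [surrogateGradients, surrogateGradients, List.zipIdx_append, List.filterMap_append,
    List.zipIdx_singleton, Nat.add_comm 1]
  split_ifs with h0 <;> simp [h0]

theorem sum_map_surrogateGradients {M : Type*} [AddCommMonoid M] {f : Vec d → M} (hf : f 0 = 0)
    (h : ℕ → ℝ) (g : ℕ → Vec d) (n : ℕ) :
    ((surrogateGradients h ((List.range n).map g)).map f).sum =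
      (((List.range n).map fun i => h (i + 1) • g i).map f).sum := by
  induction n with
  | zero => rfl
  | succ n ih =>
    rw [List.range_succ, List.map_append, List.map_singleton, surrogateGradients_append_singleton,
      List.length_map, List.length_range, List.map_append, List.sum_append, ih]
    split_ifs with h0 <;> simp [h0, hf]

theorem freeGrad_surrogateGradients (ε G : ℝ) (h : ℕ → ℝ) (g : ℕ → Vec d) (n : ℕ) :
    freeGrad ε G (surrogateGradients h ((List.range n).map g)) =
      freeGrad ε G ((List.range n).map fun i => h (i + 1) • g i) := by
  have hsum := sum_map_surrogateGradients (f := id) rfl h g n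
  rw [List.map_id, List.map_id] at hsum
  rw [freeGrad, freeGrad, hsum, sum_map_surrogateGradients (by simp) h g n]

theorem linearRegret_featureLearner (ε G : ℝ) (h : ℕ → ℝ) (g : ℕ → Vec d) (n : ℕ) (w : Vec d) :
    linearRegret (featureLearner ε G h) g n (fun i => h (i + 1) • w) =
      linearRegret (freeGrad ε G) (fun i => h (i + 1) • g i) n (fun _ => w) := by
  refine sum_congr rfl fun i _ => ?_
  rw [featureLearner, List.length_map, List.length_range, freeGrad_surrogateGradients, ← smul_sub,
    real_inner_smul_right, real_inner_smul_left]

theorem linearRegret_featureLearner_le {ε G N l : ℝ} (hε : 0 ≤ ε) (hG : 0 < G) (hN : 1 ≤ N)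
    (hl : 0 ≤ l) {h : ℕ → ℝ} (hh : ∀ t, |h t| ≤ 1) {g : ℕ → Vec d} (hg : ∀ i, ‖g i‖ ≤ G) {n : ℕ}
    (hsum : ∑ i ∈ range n, |h (i + 1)| ≤ N) {w : Vec d} (hw : 2 * N ^ 2 * ‖w‖ ≤ ε * Real.exp l) :
    linearRegret (featureLearner ε G h) g n (fun i => h (i + 1) • w) ≤
      ε * G + 4 * G * (1 + l) * (‖w‖ * √N) := by
  have hle (i : ℕ) : ‖h (i + 1) • g i‖ ≤ |h (i + 1)| * G := by
    rw [norm_smul, Real.norm_eq_abs]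
    exact mul_le_mul_of_nonneg_left (hg i) (abs_nonneg _)
  rw [linearRegret_featureLearner]
  refine linearRegret_freeGrad_le hε hG hN hl
    (fun i => (hle i).trans (mul_le_of_le_one_left hG.le (hh _))) ?_ hw
  calc ∑ i ∈ range n, ‖h (i + 1) • g i‖ ≤ ∑ i ∈ range n, |h (i + 1)| * G :=
        sum_le_sum fun i _ => hle i
    _ = (∑ i ∈ range n, |h (i + 1)|) * G := (sum_mul _ _ _).symm
    _ ≤ N * G := mul_le_mul_of_nonneg_right hsum hG.le

end FreeGrad

/-! ### Haar decomposition of a sequence -/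

section Haar

theorem haarFeature_succ (j p i : ℕ) :
    haarFeature (j + 1) (p + 1) (i + 1) =
      if i / 2 ^ (j + 1) = p then (-1) ^ (i / 2 ^ j) else 0 := by
  have hpos : 0 < 2 ^ j := by positivity
  have hdiv : i / 2 ^ (j + 1) = i / 2 ^ j / 2 := by rw [pow_succ, Nat.div_div_eq_div_mul]
  have hleft : i + 1 ∈ Icc (2 ^ (j + 1) * (p + 1 - 1) + 1)
      (2 ^ (j + 1) * (p + 1 - 1) + 2 ^ (j + 1 - 1)) ↔ i / 2 ^ j = 2 * p := by
    rw [mem_Icc, Nat.div_eq_iff hpos, Nat.add_sub_cancel, Nat.add_sub_cancel, pow_succ]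
    ring_nf
    omega
  have hright : i + 1 ∈ Icc (2 ^ (j + 1) * (p + 1 - 1) + 2 ^ (j + 1 - 1) + 1)
      (2 ^ (j + 1) * (p + 1)) ↔ i / 2 ^ j = 2 * p + 1 := by
    rw [mem_Icc, Nat.div_eq_iff hpos, Nat.add_sub_cancel, Nat.add_sub_cancel, pow_succ]
    ring_nf
    omega
  simp only [haarFeature, hleft, hright, hdiv]
  rcases Nat.even_or_odd' (i / 2 ^ j) with ⟨q, hq | hq⟩ <;> rw [hq]
  · rw [(even_two_mul q).neg_one_pow]
    grind
  · rw [(odd_two_mul_add_one q).neg_one_pow]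
    grind

theorem abs_haarFeature_le (j l t : ℕ) : |haarFeature j l t| ≤ 1 := by
  unfold haarFeature
  split_ifs <;> simp

theorem sum_abs_haarFeature_le (j p n : ℕ) :
    ∑ i ∈ range n, |haarFeature (j + 1) (p + 1) (i + 1)| ≤ 2 ^ (j + 1) := by
  have habs (i : ℕ) : |haarFeature (j + 1) (p + 1) (i + 1)| =
      if i / 2 ^ (j + 1) = p then 1 else 0 := by
    rw [haarFeature_succ]
    split_ifs <;> simp
  have hsub : {i ∈ range n | i / 2 ^ (j + 1) = p} ⊆
      Ico (p * 2 ^ (j + 1)) (p * 2 ^ (j + 1) + 2 ^ (j + 1)) := fun i hi => by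
    have hpos : 0 < 2 ^ (j + 1) := by positivity
    rw [mem_filter, Nat.div_eq_iff hpos] at hi
    rw [mem_Ico]
    omega
  have hcard := card_le_card hsub
  rw [Nat.card_Ico, Nat.add_sub_cancel_left] at hcard
  rw [sum_congr rfl fun i _ => habs i, sum_boole]
  exact_mod_cast hcard

/-- The sum of `U` over the dyadic interval `[2 ^ j * p, 2 ^ j * (p + 1))`. -/
def dyadicSum {M : Type*} [AddCommMonoid M] (U : ℕ → M) (j p : ℕ) : M :=
  ∑ i ∈ range (2 ^ j), U (2 ^ j * p + i)

theorem dyadicSum_zero {M : Type*} [AddCommMonoid M] (U : ℕ → M) (p : ℕ) :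
    dyadicSum U 0 p = U p := by
  simp [dyadicSum]

theorem dyadicSum_succ {M : Type*} [AddCommMonoid M] (U : ℕ → M) (j p : ℕ) :
    dyadicSum U (j + 1) p = dyadicSum U j (2 * p) + dyadicSum U j (2 * p + 1) := by
  rw [dyadicSum, pow_succ, mul_two, sum_range_add, dyadicSum, dyadicSum]
  congr 1 <;> refine sum_congr rfl fun i _ => congrArg U ?_ <;> ring

theorem sum_dyadicSum {M : Type*} [AddCommMonoid M] (U : ℕ → M) (j k : ℕ) :
    ∑ p ∈ range k, dyadicSum U j p = ∑ i ∈ range (2 ^ j * k), U i := by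
  induction k with
  | zero => simp
  | succ k ih => rw [sum_range_succ, ih, Nat.mul_succ, sum_range_add, dyadicSum]

theorem dyadicSum_le {f : ℕ → ℝ} {a : ℝ} (hf : ∀ i, f i ≤ a) (j p : ℕ) :
    dyadicSum f j p ≤ 2 ^ j * a := by
  have hle := sum_le_card_nsmul (range (2 ^ j)) (fun i => f (2 ^ j * p + i)) a fun i _ => hf _
  simpa [dyadicSum] using hle

theorem mul_sqrt_le_sqrt_dyadicSum_sq {f : ℕ → ℝ} {a : ℝ} {j p : ℕ} (ha : 0 ≤ a)
    (h : 2 ^ j * a ≤ dyadicSum f j p) :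
    a * √(2 ^ j) ≤ √(dyadicSum (fun i => f i ^ 2) j p) := by
  have hcauchy : dyadicSum f j p ^ 2 ≤ 2 ^ j * dyadicSum (fun i => f i ^ 2) j p := by
    have hsq := sq_sum_le_card_mul_sum_sq (s := range (2 ^ j)) (f := fun i => f (2 ^ j * p + i))
    rw [card_range] at hsq
    exact_mod_cast hsq
  apply Real.le_sqrt_of_sq_le
  rw [mul_pow, Real.sq_sqrt (by positivity)]
  refine le_of_mul_le_mul_left ?_ (by positivity : (0 : ℝ) < 2 ^ j)
  calc 2 ^ j * (a ^ 2 * 2 ^ j) = (2 ^ j * a) ^ 2 := by ring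
    _ ≤ dyadicSum f j p ^ 2 := by gcongr
    _ ≤ 2 ^ j * dyadicSum (fun i => f i ^ 2) j p := hcauchy

variable {E : Type*} [NormedAddCommGroup E] [NormedSpace ℝ E]

/-- The average of `U` over the dyadic interval `[2 ^ j * p, 2 ^ j * (p + 1))`. -/
def dyadicAverage (U : ℕ → E) (j p : ℕ) : E := ((2 : ℝ) ^ j)⁻¹ • dyadicSum U j p

/-- The coefficient of `U` with respect to the Haar feature of scale `j + 1` and location `p + 1`,
where the entries of `U` are indexed from zero. -/
def haarCoeff (U : ℕ → E) (j p : ℕ) : E :=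
  (2 : ℝ)⁻¹ • (dyadicAverage U j (2 * p) - dyadicAverage U j (2 * p + 1))

theorem dyadicAverage_zero (U : ℕ → E) (p : ℕ) : dyadicAverage U 0 p = U p := by
  rw [dyadicAverage, dyadicSum_zero, pow_zero, inv_one, one_smul]

theorem dyadicAverage_succ (U : ℕ → E) (j p : ℕ) :
    dyadicAverage U (j + 1) p =
      (2 : ℝ)⁻¹ • (dyadicAverage U j (2 * p) + dyadicAverage U j (2 * p + 1)) := by
  rw [dyadicAverage, dyadicAverage, dyadicAverage, dyadicSum_succ, ← smul_add, smul_smul, pow_succ',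
    mul_inv]

theorem dyadicAverage_eq_add_haarCoeff (U : ℕ → E) (j q : ℕ) :
    dyadicAverage U j q =
      dyadicAverage U (j + 1) (q / 2) + (-1 : ℝ) ^ q • haarCoeff U j (q / 2) := by
  rcases Nat.even_or_odd' q with ⟨p, rfl | rfl⟩
  · rw [show 2 * p / 2 = p by omega, (even_two_mul p).neg_one_pow, dyadicAverage_succ, haarCoeff]
    module
  · rw [show (2 * p + 1) / 2 = p by omega, (odd_two_mul_add_one p).neg_one_pow, dyadicAverage_succ,
      haarCoeff]
    module

theorem sum_haarFeature_smul_haarCoeff (U : ℕ → E) {m j i : ℕ} (hj : j < m) (hi : i < 2 ^ m) :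
    ∑ p ∈ range (2 ^ (m - (j + 1))), haarFeature (j + 1) (p + 1) (i + 1) • haarCoeff U j p =
      dyadicAverage U j (i / 2 ^ j) - dyadicAverage U (j + 1) (i / 2 ^ (j + 1)) := by
  have hmem : i / 2 ^ (j + 1) ∈ range (2 ^ (m - (j + 1))) := by
    rw [mem_range, Nat.div_lt_iff_lt_mul (by positivity), ← pow_add]
    rwa [Nat.sub_add_cancel hj]
  have hdiv : i / 2 ^ (j + 1) = i / 2 ^ j / 2 := by rw [pow_succ, Nat.div_div_eq_div_mul]
  simp only [haarFeature_succ, ite_smul, zero_smul]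
  rw [sum_ite_eq, if_pos hmem, dyadicAverage_eq_add_haarCoeff U j, hdiv, add_sub_cancel_left]

theorem haar_reconstruction (U : ℕ → E) {m i : ℕ} (hi : i < 2 ^ m) :
    U i = dyadicAverage U m 0 + ∑ j ∈ range m, ∑ p ∈ range (2 ^ (m - (j + 1))),
      haarFeature (j + 1) (p + 1) (i + 1) • haarCoeff U j p := by
  rw [sum_congr rfl fun j hj => sum_haarFeature_smul_haarCoeff U (mem_range.1 hj) hi,
    sum_range_sub' (fun j => dyadicAverage U j (i / 2 ^ j)), Nat.div_eq_of_lt hi, pow_zero,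
    Nat.div_one, dyadicAverage_zero, add_sub_cancel]

theorem dyadicAverage_eq_const {U : ℕ → E} {j p : ℕ} {c : E} (h : ∀ i, i / 2 ^ j = p → U i = c) :
    dyadicAverage U j p = c := by
  have hU : ∀ i ∈ range (2 ^ j), U (2 ^ j * p + i) = c := fun i hi => h _ <| by
    rw [Nat.mul_add_div (by positivity), Nat.div_eq_of_lt (mem_range.1 hi), add_zero]
  rw [dyadicAverage, dyadicSum, sum_congr rfl hU, sum_const, card_range,
    ← Nat.cast_smul_eq_nsmul ℝ, Nat.cast_pow, Nat.cast_ofNat, inv_smul_smul₀ (by positivity)]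

theorem dyadicAverage_sub_const (U : ℕ → E) (c : E) (j p : ℕ) :
    dyadicAverage (fun i => U i - c) j p = dyadicAverage U j p - c := by
  conv_rhs => rw [← dyadicAverage_eq_const (U := fun _ => c) (j := j) (p := p) fun _ _ => rfl]
  rw [dyadicAverage, dyadicAverage, dyadicAverage, ← smul_sub, dyadicSum, dyadicSum, dyadicSum,
    sum_sub_distrib]

theorem haarCoeff_sub_const (U : ℕ → E) (c : E) (j p : ℕ) :
    haarCoeff (fun i => U i - c) j p = haarCoeff U j p := by
  rw [haarCoeff, haarCoeff, dyadicAverage_sub_const, dyadicAverage_sub_const,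
    sub_sub_sub_cancel_right]

theorem haarCoeff_eq_zero {U : ℕ → E} {j p : ℕ}
    (h : ∀ i, i / 2 ^ (j + 1) = p → U (i + 1) = U i) : haarCoeff U j p = 0 := by
  have hconst : ∀ i, i / 2 ^ (j + 1) = p → U i = U (p * 2 ^ (j + 1)) := by
    intro i hi
    obtain ⟨hle, hlt⟩ := (Nat.div_eq_iff (by positivity)).1 hi
    induction i, hle using Nat.le_induction with
    | base => rfl
    | succ i hle ih =>
      have hi' : i / 2 ^ (j + 1) = p := (Nat.div_eq_iff (by positivity)).2 ⟨hle, by omega⟩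
      rw [h i hi', ih hi' (by omega)]
  have hhalf (b : ℕ) (hb : b / 2 = p) : dyadicAverage U j b = U (p * 2 ^ (j + 1)) :=
    dyadicAverage_eq_const fun i hi => hconst i <| by
      rw [pow_succ, ← Nat.div_div_eq_div_mul, hi, hb]
  rw [haarCoeff, hhalf (2 * p) (by omega), hhalf (2 * p + 1) (by omega), sub_self, smul_zero]

theorem two_pow_mul_norm_dyadicAverage_le (U : ℕ → E) (j p : ℕ) :
    2 ^ j * ‖dyadicAverage U j p‖ ≤ dyadicSum (fun i => ‖U i‖) j p := by
  rw [dyadicAverage, norm_smul, Real.norm_of_nonneg (by positivity),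
    mul_inv_cancel_left₀ (by positivity)]
  exact norm_sum_le _ _

theorem two_pow_mul_norm_haarCoeff_le (U : ℕ → E) (j p : ℕ) :
    2 ^ (j + 1) * ‖haarCoeff U j p‖ ≤ dyadicSum (fun i => ‖U i‖) (j + 1) p := by
  have hnorm : 2 * ‖haarCoeff U j p‖ ≤
      ‖dyadicAverage U j (2 * p)‖ + ‖dyadicAverage U j (2 * p + 1)‖ := by
    rw [haarCoeff, norm_smul, Real.norm_of_nonneg (by positivity),
      mul_inv_cancel_left₀ two_ne_zero]
    exact norm_sub_le _ _
  rw [pow_succ, mul_assoc, dyadicSum_succ]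
  exact (mul_le_mul_of_nonneg_left hnorm (by positivity)).trans
    ((mul_add _ _ _).trans_le (add_le_add (two_pow_mul_norm_dyadicAverage_le U j _)
      (two_pow_mul_norm_dyadicAverage_le U j _)))

theorem norm_dyadicAverage_le {U : ℕ → E} {M : ℝ} (hU : ∀ i, ‖U i‖ ≤ M) (j p : ℕ) :
    ‖dyadicAverage U j p‖ ≤ M :=
  le_of_mul_le_mul_left ((two_pow_mul_norm_dyadicAverage_le U j p).trans (dyadicSum_le hU j p))
    (by positivity)

theorem norm_haarCoeff_le {U : ℕ → E} {M : ℝ} (hU : ∀ i, ‖U i‖ ≤ M) (j p : ℕ) :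
    ‖haarCoeff U j p‖ ≤ M :=
  le_of_mul_le_mul_left ((two_pow_mul_norm_haarCoeff_le U j p).trans (dyadicSum_le hU (j + 1) p))
    (by positivity)

theorem norm_dyadicAverage_mul_sqrt_le (U : ℕ → E) (c : E) (m : ℕ) :
    ‖dyadicAverage U m 0‖ * √(2 ^ m) ≤
      ‖c‖ * √(2 ^ m) + √(∑ i ∈ range (2 ^ m), ‖U i - c‖ ^ 2) := by
  have hcenter : ‖dyadicAverage U m 0‖ ≤ ‖c‖ + ‖dyadicAverage (fun i => U i - c) m 0‖ := by
    rw [dyadicAverage_sub_const]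
    exact norm_le_norm_add_norm_sub' _ _
  have hdev := mul_sqrt_le_sqrt_dyadicSum_sq (norm_nonneg _)
    (two_pow_mul_norm_dyadicAverage_le (fun i => U i - c) m 0)
  rw [dyadicSum, mul_zero] at hdev
  simp only [zero_add] at hdev
  calc ‖dyadicAverage U m 0‖ * √(2 ^ m)
      ≤ (‖c‖ + ‖dyadicAverage (fun i => U i - c) m 0‖) * √(2 ^ m) := by gcongr
    _ ≤ ‖c‖ * √(2 ^ m) + √(∑ i ∈ range (2 ^ m), ‖U i - c‖ ^ 2) := by
        rw [add_mul]
        gcongr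

theorem sum_norm_haarCoeff_mul_sqrt_le {U : ℕ → E} {S : Finset ℕ}
    (hS : ∀ i, U (i + 1) ≠ U i → i ∈ S) (c : E) {m j : ℕ} (hj : j < m) :
    ∑ p ∈ range (2 ^ (m - (j + 1))), ‖haarCoeff U j p‖ * √(2 ^ (j + 1)) ≤
      √(#S * ∑ i ∈ range (2 ^ m), ‖U i - c‖ ^ 2) := by
  classical
  set R := range (2 ^ (m - (j + 1)))
  set Z := {p ∈ R | haarCoeff U j p ≠ 0}
  have hcard : #Z ≤ #S := by
    refine (card_le_card fun p hp => ?_).trans (card_image_le (f := fun i => i / 2 ^ (j + 1)))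
    by_contra hp'
    refine (mem_filter.1 hp).2 (haarCoeff_eq_zero fun i hi => ?_)
    by_contra hne
    exact hp' (mem_image.2 ⟨i, hS i hne, hi⟩)
  have hnonneg (p : ℕ) : 0 ≤ dyadicSum (fun i => ‖U i - c‖ ^ 2) (j + 1) p :=
    sum_nonneg fun i _ => sq_nonneg _
  have hcoeff (p : ℕ) : (‖haarCoeff U j p‖ * √(2 ^ (j + 1))) ^ 2 ≤
      dyadicSum (fun i => ‖U i - c‖ ^ 2) (j + 1) p := by
    refine (Real.le_sqrt (by positivity) (hnonneg p)).1 ?_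
    rw [← haarCoeff_sub_const U c]
    exact mul_sqrt_le_sqrt_dyadicSum_sq (norm_nonneg _) (two_pow_mul_norm_haarCoeff_le _ j p)
  apply Real.le_sqrt_of_sq_le
  calc (∑ p ∈ R, ‖haarCoeff U j p‖ * √(2 ^ (j + 1))) ^ 2
      = (∑ p ∈ Z, ‖haarCoeff U j p‖ * √(2 ^ (j + 1))) ^ 2 := by
        rw [sum_filter_of_ne fun p _ hp => norm_ne_zero_iff.1 (left_ne_zero_of_mul hp)]
    _ ≤ #Z * ∑ p ∈ Z, (‖haarCoeff U j p‖ * √(2 ^ (j + 1))) ^ 2 := sq_sum_le_card_mul_sum_sq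
    _ ≤ #S * ∑ p ∈ R, dyadicSum (fun i => ‖U i - c‖ ^ 2) (j + 1) p := by
        gcongr ?_ * ?_
        · exact_mod_cast hcard
        · exact (sum_le_sum fun p _ => hcoeff p).trans
            (sum_le_sum_of_subset_of_nonneg (filter_subset _ _) fun p _ _ => hnonneg p)
    _ = #S * ∑ i ∈ range (2 ^ m), ‖U i - c‖ ^ 2 := by
        rw [sum_dyadicSum, ← pow_add, Nat.add_sub_cancel' hj]

end Haar

/-! ### Regret of Haar OLR -/

theorem sum_Icc_one_eq_sum_range {M : Type*} [AddCommMonoid M] (f : ℕ → M) (n : ℕ) :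
    ∑ i ∈ Icc 1 n, f i = ∑ i ∈ range n, f (i + 1) := by
  induction n with
  | zero => rfl
  | succ n ih => rw [sum_Icc_succ_top (Nat.le_add_left 1 n), ih, sum_range_succ]

theorem one_add_sum_two_pow (m : ℕ) : 1 + ∑ j ∈ range m, 2 ^ (m - (j + 1)) = 2 ^ m := by
  have hgeom := Nat.geomSum_eq le_rfl m
  rw [← sum_range_reflect] at hgeom
  simp only [Nat.sub_sub, Nat.add_comm 1] at hgeom
  have hpos : 0 < 2 ^ m := by positivity
  omega

section HaarOLR

variable {d : ℕ}

theorem haarOLR_eq (m : ℕ) (ε G : ℝ) :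
    haarOLR (d := d) m ε G = featureLearner (ε / 2 ^ m) G (fun _ => 1) +
      ∑ j ∈ range m, ∑ p ∈ range (2 ^ (m - (j + 1))),
        featureLearner (ε / 2 ^ m) G (haarFeature (j + 1) (p + 1)) := by
  funext gs
  simp only [haarOLR, sum_Icc_one_eq_sum_range, Pi.add_apply, Finset.sum_apply]

theorem linearRegret_haarOLR (ε G : ℝ) (g : ℕ → Vec d) {m n : ℕ} (hn : n ≤ 2 ^ m) (U : ℕ → Vec d) :
    linearRegret (haarOLR m ε G) g n U =
      linearRegret (featureLearner (ε / 2 ^ m) G fun _ => 1) g n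
        (fun _ => (1 : ℝ) • dyadicAverage U m 0) +
      ∑ j ∈ range m, ∑ p ∈ range (2 ^ (m - (j + 1))),
        linearRegret (featureLearner (ε / 2 ^ m) G (haarFeature (j + 1) (p + 1))) g n
          (fun i => haarFeature (j + 1) (p + 1) (i + 1) • haarCoeff U j p) := by
  simp only [← linearRegret_sum, ← linearRegret_add, ← haarOLR_eq]
  refine linearRegret_congr fun i hi => ?_
  simpa only [Pi.add_apply, Finset.sum_apply, one_smul] using
    haar_reconstruction U (hi.trans_le hn)

theorem linearRegret_haarOLR_le {ε G l M : ℝ} (hε : 0 ≤ ε) (hG : 0 < G) (hl : 0 ≤ l)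
    {g : ℕ → Vec d} (hg : ∀ i, ‖g i‖ ≤ G) {m n : ℕ} (hn : n ≤ 2 ^ m) {U : ℕ → Vec d}
    (hU : ∀ i, ‖U i‖ ≤ M) (hM : 2 * (2 ^ m) ^ 3 * M ≤ ε * Real.exp l) :
    linearRegret (haarOLR m ε G) g n U ≤
      ε * G + 4 * G * (1 + l) * (‖dyadicAverage U m 0‖ * √(2 ^ m) +
        ∑ j ∈ range m, ∑ p ∈ range (2 ^ (m - (j + 1))), ‖haarCoeff U j p‖ * √(2 ^ (j + 1))) := by
  have hweight {j : ℕ} {w : Vec d} (hj : j ≤ m) (hw : ‖w‖ ≤ M) :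
      2 * (2 ^ j) ^ 2 * ‖w‖ ≤ ε / 2 ^ m * Real.exp l := by
    rw [div_mul_eq_mul_div, le_div_iff₀ (by positivity)]
    calc 2 * (2 ^ j) ^ 2 * ‖w‖ * 2 ^ m ≤ 2 * (2 ^ m) ^ 2 * M * 2 ^ m := by
          gcongr
          norm_num
      _ = 2 * (2 ^ m) ^ 3 * M := by ring
      _ ≤ ε * Real.exp l := hM
  have hconst : linearRegret (featureLearner (ε / 2 ^ m) G fun _ => 1) g n
      (fun _ => (1 : ℝ) • dyadicAverage U m 0) ≤
      ε / 2 ^ m * G + 4 * G * (1 + l) * (‖dyadicAverage U m 0‖ * √(2 ^ m)) :=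
    linearRegret_featureLearner_le (by positivity) hG (one_le_pow₀ one_le_two) hl (by simp) hg
      (by simpa using mod_cast hn) (hweight le_rfl (norm_dyadicAverage_le hU m 0))
  have hfeature : ∀ j ∈ range m, ∀ p ∈ range (2 ^ (m - (j + 1))),
      linearRegret (featureLearner (ε / 2 ^ m) G (haarFeature (j + 1) (p + 1))) g n
        (fun i => haarFeature (j + 1) (p + 1) (i + 1) • haarCoeff U j p) ≤
      ε / 2 ^ m * G + 4 * G * (1 + l) * (‖haarCoeff U j p‖ * √(2 ^ (j + 1))) := fun j hj p _ =>
    linearRegret_featureLearner_le (by positivity) hG (one_le_pow₀ one_le_two) hl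
      (abs_haarFeature_le _ _) hg (sum_abs_haarFeature_le j p n)
      (hweight (mem_range.1 hj) (norm_haarCoeff_le hU j p))
  have hcount : ε / 2 ^ m * G + (∑ j ∈ range m, 2 ^ (m - (j + 1))) * (ε / 2 ^ m * G) = ε * G := by
    have h := congrArg (Nat.cast (R := ℝ)) (one_add_sum_two_pow m)
    push_cast at h
    rw [← one_add_mul, h]
    field_simp
  rw [linearRegret_haarOLR ε G g hn U]
  refine (add_le_add hconst (sum_le_sum fun j hj => sum_le_sum (hfeature j hj))).trans_eq ?_
  rw [← hcount]
  generalize ε / 2 ^ m * G = a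
  simp only [sum_add_distrib, ← mul_sum, ← sum_mul, sum_const, card_range, nsmul_eq_mul,
    Nat.cast_pow, Nat.cast_ofNat]
  ring

theorem linearRegret_haarOLR_le_of_switches {ε G l M : ℝ} (hε : 0 ≤ ε) (hG : 0 < G) (hl : 0 ≤ l)
    {g : ℕ → Vec d} (hg : ∀ i, ‖g i‖ ≤ G) {m n : ℕ} (hn : n ≤ 2 ^ m) {U : ℕ → Vec d}
    (hU : ∀ i, ‖U i‖ ≤ M) (hM : 2 * (2 ^ m) ^ 3 * M ≤ ε * Real.exp l) {S : Finset ℕ}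
    (hS : ∀ i, U (i + 1) ≠ U i → i ∈ S) (c : Vec d) :
    linearRegret (haarOLR m ε G) g n U ≤
      ε * G + 4 * G * (1 + l) * (‖c‖ * √(2 ^ m) + √(∑ i ∈ range (2 ^ m), ‖U i - c‖ ^ 2) +
        m * √(#S * ∑ i ∈ range (2 ^ m), ‖U i - c‖ ^ 2)) := by
  refine (linearRegret_haarOLR_le hε hG hl hg hn hU hM).trans ?_
  gcongr ε * G + 4 * G * (1 + l) * (?_ + ?_)
  · exact norm_dyadicAverage_mul_sqrt_le U c m
  · have hscale := sum_le_card_nsmul (range m) _ _ fun j hj =>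
      sum_norm_haarCoeff_mul_sqrt_le hS c (mem_range.1 hj)
    rwa [card_range, nsmul_eq_mul] at hscale

end HaarOLR

/-! ### Reduction of the game to linear losses -/

section Game

variable {d : ℕ} {G : ℝ≥0}

theorem Environment.norm_grad_le (env : Environment d G) (past : List (Vec d)) (x : Vec d) :
    ‖env.grad past x‖ ≤ G := by
  set g := env.grad past x with hg
  have hsub := env.subgradient past x (x + g)
  rw [add_sub_cancel_left, ← hg, real_inner_self_eq_norm_sq] at hsub
  have hlip : env.loss past x (x + g) ≤ env.loss past x x + G * ‖g‖ := by
    simpa only [dist_self_add_left] using (env.lipschitz past x).le_add_mul (x + g) x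
  by_contra! hlt
  nlinarith [G.coe_nonneg]

/-- The gradient revealed in round `i + 1` of the game. -/
def playGradient (A : OnlineAlgorithm d) (env : Environment d G) (i : ℕ) : Vec d :=
  env.grad (play A env i).1 (A (play A env i).2)

theorem play_snd (A : OnlineAlgorithm d) (env : Environment d G) (n : ℕ) :
    (play A env n).2 = (List.range n).map (playGradient A env) := by
  induction n with
  | zero => rfl
  | succ n ih =>
    rw [List.range_succ, List.map_append, ← ih]
    rfl

theorem sum_roundLoss_sub_le_linearRegret (A : OnlineAlgorithm d) (env : Environment d G) (T : ℕ)
    (u : ℕ → Vec d) :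
    ∑ t ∈ Icc 1 T, roundLoss A env t (prediction A env t) - ∑ t ∈ Icc 1 T, roundLoss A env t (u t) ≤
      linearRegret A (playGradient A env) T fun i => u (i + 1) := by
  rw [← sum_sub_distrib, sum_Icc_one_eq_sum_range]
  refine sum_le_sum fun i _ => ?_
  have hsub := env.subgradient (play A env i).1 (A (play A env i).2) (u (i + 1))
  rw [← neg_sub, inner_neg_right] at hsub
  simp only [roundLoss, prediction, Nat.add_sub_cancel, ← play_snd, playGradient]
  linarith

end Game

/-! ### Statistics of the comparator sequence -/

section Comparator

variable {d : ℕ}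

theorem norm_le_maxRange {T t : ℕ} (ht : t ∈ Icc 1 T) (u : ℕ → Vec d) : ‖u t‖ ≤ maxRange T u := by
  exact_mod_cast le_sup (f := fun t => ‖u t‖₊) ht

theorem norm_comparatorAverage_le (T : ℕ) (u : ℕ → Vec d) :
    ‖comparatorAverage T u‖ ≤ maxRange T u := by
  have hsum : ‖∑ t ∈ Icc 1 T, u t‖ ≤ T * maxRange T u := by
    simpa using norm_sum_le_of_le (Icc 1 T) fun t ht => norm_le_maxRange ht u
  rw [comparatorAverage, norm_smul, norm_inv, Real.norm_natCast]
  exact inv_mul_le_of_le_mul₀ (Nat.cast_nonneg T) (maxRange T u).coe_nonneg hsum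

open Classical in
theorem numSwitches_eq_card (T : ℕ) (u : ℕ → Vec d) :
    numSwitches T u = #{i ∈ range (T - 1) | u (i + 1 + 1) ≠ u (i + 1)} := by
  rw [numSwitches, sum_Icc_one_eq_sum_range, card_filter]

theorem eq_comparatorAverage_of_numSwitches_eq_zero {T : ℕ} {u : ℕ → Vec d}
    (hK : numSwitches T u = 0) {i : ℕ} (hi : i < T) : u (i + 1) = comparatorAverage T u := by
  classical
  have hconst : ∀ i < T, u (i + 1) = u 1 := by
    rw [numSwitches_eq_card, card_eq_zero, filter_eq_empty_iff] at hK
    intro i hi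
    induction i with
    | zero => rfl
    | succ i ih => rw [← ih (by omega), not_not.1 (hK (mem_range.2 (by omega : i < T - 1)))]
  have hT : (T : ℝ) ≠ 0 := by
    rw [Nat.cast_ne_zero]
    omega
  rw [comparatorAverage, sum_Icc_one_eq_sum_range,
    sum_congr rfl fun k hk => hconst k (mem_range.1 hk), hconst i hi, sum_const, card_range,
    ← Nat.cast_smul_eq_nsmul ℝ, inv_smul_smul₀ hT]

theorem secondOrderVariability_nonneg (T : ℕ) (u : ℕ → Vec d) : 0 ≤ secondOrderVariability T u :=
  sum_nonneg fun _ _ => sq_nonneg _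

theorem secondOrderVariability_le_numSwitches_mul (T : ℕ) (u : ℕ → Vec d) :
    secondOrderVariability T u ≤ numSwitches T u * secondOrderVariability T u := by
  rcases Nat.eq_zero_or_pos (numSwitches T u) with hK | hK
  · rw [hK, Nat.cast_zero, zero_mul, secondOrderVariability, sum_Icc_one_eq_sum_range]
    refine (sum_eq_zero fun i hi => ?_).le
    rw [eq_comparatorAverage_of_numSwitches_eq_zero hK (mem_range.1 hi), sub_self, norm_zero,
      zero_pow two_ne_zero]
  · exact le_mul_of_one_le_left (secondOrderVariability_nonneg T u) (by exact_mod_cast hK)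

/-- The comparator sequence, indexed from zero and continued after round `T` by its average. A
block of the algorithm that is cut off by the end of the game can then be treated as a complete
one, at the cost of at most one switch. -/
def paddedComparator (T : ℕ) (u : ℕ → Vec d) (i : ℕ) : Vec d :=
  if i < T then u (i + 1) else comparatorAverage T u

theorem norm_paddedComparator_le (T : ℕ) (u : ℕ → Vec d) (i : ℕ) :
    ‖paddedComparator T u i‖ ≤ maxRange T u := by
  unfold paddedComparator
  split_ifs with hi
  · exact norm_le_maxRange (mem_Icc.2 ⟨by omega, hi⟩) u
  · exact norm_comparatorAverage_le T u

theorem sum_norm_sq_paddedComparator_sub_le (T : ℕ) (u : ℕ → Vec d) (o n : ℕ) :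
    ∑ i ∈ range n, ‖paddedComparator T u (o + i) - comparatorAverage T u‖ ^ 2 ≤
      secondOrderVariability T u := by
  set f := fun i => ‖paddedComparator T u i - comparatorAverage T u‖ ^ 2 with hf
  have hsupport : ∀ i ∈ Ico o (o + n), f i ≠ 0 → i < T := fun i _ hi => by
    by_contra hiT
    exact hi (by simp [hf, paddedComparator, hiT])
  calc ∑ i ∈ range n, f (o + i) = ∑ i ∈ Ico o (o + n) with i < T, f i := by
        rw [sum_filter_of_ne hsupport, sum_Ico_eq_sum_range, Nat.add_sub_cancel_left]
    _ ≤ ∑ i ∈ range T, f i :=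
        sum_le_sum_of_subset_of_nonneg (fun i hi => mem_range.2 (mem_filter.1 hi).2)
          fun i _ _ => sq_nonneg _
    _ = secondOrderVariability T u := by
        rw [secondOrderVariability, sum_Icc_one_eq_sum_range]
        refine sum_congr rfl fun i hi => ?_
        simp only [hf, paddedComparator, if_pos (mem_range.1 hi)]

theorem exists_switches_paddedComparator (T : ℕ) (u : ℕ → Vec d) :
    ∃ S : Finset ℕ, #S ≤ 2 * numSwitches T u ∧
      ∀ i, paddedComparator T u (i + 1) ≠ paddedComparator T u i → i ∈ S := by
  classical
  rcases Nat.eq_zero_or_pos (numSwitches T u) with hK | hK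
  · have hconst (i : ℕ) : paddedComparator T u i = comparatorAverage T u := by
      unfold paddedComparator
      split_ifs with hi
      · exact eq_comparatorAverage_of_numSwitches_eq_zero hK hi
      · rfl
    exact ⟨∅, by simp, fun i hi => absurd ((hconst _).trans (hconst _).symm) hi⟩
  · refine ⟨insert (T - 1) {i ∈ range (T - 1) | u (i + 1 + 1) ≠ u (i + 1)}, ?_, fun i hi => ?_⟩
    · have hcard := card_insert_le (T - 1) {i ∈ range (T - 1) | u (i + 1 + 1) ≠ u (i + 1)}
      rw [← numSwitches_eq_card] at hcard
      omega
    · rw [mem_insert, mem_filter, mem_range]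
      unfold paddedComparator at hi
      grind

end Comparator

/-! ### Regret of anytime Haar OLR -/

section Anytime

variable {d : ℕ}

/-- The logarithmic factor `1 + log T + log (1 + M)` of the regret bound. -/
def logFactor (T : ℕ) (u : ℕ → Vec d) : ℝ := 1 + Real.log T + Real.log (1 + maxRange T u)

/-- The leading term `‖ū‖ √T + √(K Ē)` of the regret bound. -/
def switchingRate (T : ℕ) (u : ℕ → Vec d) : ℝ :=
  ‖comparatorAverage T u‖ * √(T : ℝ) + √((numSwitches T u : ℝ) * secondOrderVariability T u)

theorem switchingRate_nonneg (T : ℕ) (u : ℕ → Vec d) : 0 ≤ switchingRate T u := by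
  unfold switchingRate
  positivity

theorem one_add_log_le_logFactor (T : ℕ) (u : ℕ → Vec d) : 1 + Real.log T ≤ logFactor T u :=
  le_add_of_nonneg_right (Real.log_nonneg (le_add_of_nonneg_right (maxRange T u).coe_nonneg))

theorem one_le_logFactor (T : ℕ) (u : ℕ → Vec d) : 1 ≤ logFactor T u :=
  (le_add_of_nonneg_right (Real.log_natCast_nonneg T)).trans (one_add_log_le_logFactor T u)

theorem natCast_le_two_mul_log {m : ℕ} {x : ℝ} (h : 2 ^ m ≤ x) : (m : ℝ) ≤ 2 * Real.log x := by
  have hlog := Real.log_le_log (by positivity) h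
  rw [Real.log_pow] at hlog
  nlinarith [Real.log_two_gt_d9, m.cast_nonneg (α := ℝ)]

theorem natCast_le_two_mul_logFactor {m T : ℕ} (h : 2 ^ m ≤ 2 * T) (u : ℕ → Vec d) :
    (m : ℝ) ≤ 2 * logFactor T u := by
  have hT : (T : ℝ) ≠ 0 := by
    rintro hT
    simp_all
  have hm : (m : ℝ) ≤ 2 * Real.log (2 * T) := natCast_le_two_mul_log (by exact_mod_cast h)
  rw [Real.log_mul two_ne_zero hT] at hm
  linarith [one_add_log_le_logFactor T u, Real.log_two_lt_d9]

theorem two_mul_mul_le_exp_logFactor {T : ℕ} (hT : T ≠ 0) (u : ℕ → Vec d) :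
    2 * T * (1 + maxRange T u) ≤ Real.exp (logFactor T u) := by
  have hT' : (0 : ℝ) < T := by positivity
  have hM : (0 : ℝ) < 1 + maxRange T u := by positivity
  rw [logFactor, Real.exp_add, Real.exp_add, Real.exp_log hT', Real.exp_log hM]
  gcongr
  linarith [Real.exp_one_gt_d9]

theorem two_mul_cube_mul_le_exp_logFactor {T : ℕ} (hT : T ≠ 0) (u : ℕ → Vec d) {N : ℝ}
    (hN : 0 ≤ N) (hNT : N ≤ 2 * T) :
    2 * N ^ 3 * maxRange T u ≤ Real.exp (4 * logFactor T u) := by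
  have hT' : (1 : ℝ) ≤ T := by exact_mod_cast Nat.one_le_iff_ne_zero.2 hT
  have hM : (maxRange T u : ℝ) ≤ (1 + maxRange T u) ^ 4 :=
    (le_add_of_nonneg_left zero_le_one).trans
      (le_self_pow₀ (le_add_of_nonneg_right (maxRange T u).coe_nonneg) four_ne_zero)
  calc 2 * N ^ 3 * maxRange T u ≤ 2 * T * (2 * T) ^ 3 * (1 + maxRange T u : ℝ) ^ 4 := by
        gcongr
        linarith
    _ = (2 * T * (1 + maxRange T u : ℝ)) ^ 4 := by ring
    _ ≤ Real.exp (logFactor T u) ^ 4 := by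
        gcongr
        exact two_mul_mul_le_exp_logFactor hT u
    _ = Real.exp (4 * logFactor T u) := by rw [← Real.exp_nat_mul, Nat.cast_ofNat]

theorem block_rate_le {T m s : ℕ} (hmT : 2 ^ m ≤ 2 * T) (u : ℕ → Vec d) {Q : ℝ}
    (hQ : Q ≤ secondOrderVariability T u) (hs : s ≤ 2 * numSwitches T u) :
    ‖comparatorAverage T u‖ * √(2 ^ m) + √Q + m * √(s * Q) ≤
      5 * logFactor T u * switchingRate T u := by
  set P := logFactor T u
  set X := ‖comparatorAverage T u‖ * √(T : ℝ)
  set Y := √((numSwitches T u : ℝ) * secondOrderVariability T u)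
  have hP : 1 ≤ P := one_le_logFactor T u
  have haverage : ‖comparatorAverage T u‖ * √(2 ^ m) ≤ 2 * X := by
    have hsqrt : √(2 ^ m) ≤ 2 * √(T : ℝ) := by
      have hmT' : (2 : ℝ) ^ m ≤ 2 * T := by exact_mod_cast hmT
      rw [Real.sqrt_le_left (by positivity), mul_pow, Real.sq_sqrt T.cast_nonneg]
      linarith [T.cast_nonneg (α := ℝ)]
    exact (mul_le_mul_of_nonneg_left hsqrt (norm_nonneg _)).trans_eq (mul_left_comm _ _ _)
  have hdeviation : √Q ≤ Y :=
    Real.sqrt_le_sqrt (hQ.trans (secondOrderVariability_le_numSwitches_mul T u))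
  have hswitches : √(s * Q) ≤ 2 * Y := by
    have hs' : (s : ℝ) ≤ 2 * numSwitches T u := by exact_mod_cast hs
    have hE := secondOrderVariability_nonneg T u
    rw [Real.sqrt_le_left (by positivity), mul_pow, Real.sq_sqrt (by positivity), ← mul_assoc]
    calc s * Q ≤ s * secondOrderVariability T u := by gcongr
      _ ≤ 2 ^ 2 * numSwitches T u * secondOrderVariability T u := by
          gcongr
          linarith [(numSwitches T u).cast_nonneg (α := ℝ)]
  calc ‖comparatorAverage T u‖ * √(2 ^ m) + √Q + m * √(s * Q)
      ≤ P * (5 * X) + P * Y + 2 * P * (2 * Y) := by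
        gcongr ?_ + ?_ + ?_ * ?_
        · have hX : 0 ≤ X := by positivity
          nlinarith
        · exact hdeviation.trans (le_mul_of_one_le_left (Real.sqrt_nonneg _) hP)
        · exact natCast_le_two_mul_logFactor hmT u
    _ = 5 * P * (X + Y) := by ring

/-- An upper bound on the regret that anytime Haar OLR accumulates in a single block. -/
def blockRegretBound (G : ℝ) (T : ℕ) (u : ℕ → Vec d) : ℝ :=
  G + 100 * G * logFactor T u ^ 2 * switchingRate T u

theorem linearRegret_haarOLR_block_le {G : ℝ} (hG : 0 < G) {g : ℕ → Vec d} (hg : ∀ i, ‖g i‖ ≤ G)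
    {T m n o : ℕ} (hmT : 2 ^ m ≤ 2 * T) (hn : n ≤ 2 ^ m) (hnT : o + n ≤ T) (u : ℕ → Vec d) :
    linearRegret (haarOLR m 1 G) g n (fun i => u (o + i + 1)) ≤ blockRegretBound G T u := by
  have hT : T ≠ 0 := by
    have hpos : 0 < 2 ^ m := by positivity
    omega
  have hP : 1 ≤ logFactor T u := one_le_logFactor T u
  obtain ⟨S, hcard, hS⟩ := exists_switches_paddedComparator T u
  have hshift (i : ℕ) (hi : paddedComparator T u (o + (i + 1)) ≠ paddedComparator T u (o + i)) :
      i ∈ S.image (· - o) :=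
    mem_image.2 ⟨o + i, hS _ hi, Nat.add_sub_cancel_left o i⟩
  have hexp : 2 * (2 ^ m) ^ 3 * (maxRange T u : ℝ) ≤ 1 * Real.exp (4 * logFactor T u) := by
    rw [one_mul]
    exact two_mul_cube_mul_le_exp_logFactor hT u (by positivity) (by exact_mod_cast hmT)
  calc linearRegret (haarOLR m 1 G) g n (fun i => u (o + i + 1))
      = linearRegret (haarOLR m 1 G) g n (fun i => paddedComparator T u (o + i)) :=
        linearRegret_congr fun i hi => (if_pos (by omega)).symm
    _ ≤ 1 * G + 4 * G * (1 + 4 * logFactor T u) * _ :=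
        linearRegret_haarOLR_le_of_switches zero_le_one hG (by positivity) hg hn
          (fun i => norm_paddedComparator_le T u (o + i)) hexp hshift (comparatorAverage T u)
    _ ≤ 1 * G + 4 * G * (5 * logFactor T u) * (5 * logFactor T u * switchingRate T u) := by
        gcongr
        · linarith
        · exact block_rate_le hmT u (sum_norm_sq_paddedComparator_sub_le T u o _)
            (card_image_le.trans hcard)
    _ = blockRegretBound G T u := by
        rw [blockRegretBound]
        ring

theorem anytimeHaarOLR_apply (G : ℝ) (g : ℕ → Vec d) {m i : ℕ} (hm : m ≠ 0) (hi : i < 2 ^ m) :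
    anytimeHaarOLR G ((List.range (2 ^ m - 2 + i)).map g) =
      haarOLR m 1 G ((List.range i).map fun k => g (2 ^ m - 2 + k)) := by
  have htwo : 2 ≤ 2 ^ m := le_self_pow₀ one_le_two hm
  have hlog : Nat.log 2 (2 ^ m - 2 + i + 2) = m := by
    rw [Nat.log_eq_iff (Or.inl hm), pow_succ]
    omega
  simp only [anytimeHaarOLR, List.length_map, List.length_range, hlog]
  rw [List.range_add, List.map_append, List.drop_left' (by simp), List.map_map]
  rfl

theorem linearRegret_anytimeHaarOLR_add (G : ℝ) (g w : ℕ → Vec d) {m n : ℕ} (hm : m ≠ 0)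
    (hn : n ≤ 2 ^ m) :
    linearRegret (anytimeHaarOLR G) g (2 ^ m - 2 + n) w =
      linearRegret (anytimeHaarOLR G) g (2 ^ m - 2) w +
        linearRegret (haarOLR m 1 G) (fun k => g (2 ^ m - 2 + k)) n
          (fun k => w (2 ^ m - 2 + k)) := by
  rw [linearRegret, sum_range_add]
  refine congrArg _ (sum_congr rfl fun i hi => ?_)
  rw [anytimeHaarOLR_apply G g hm ((mem_range.1 hi).trans_le hn)]

theorem linearRegret_anytimeHaarOLR_le_mul {G : ℝ} (hG : 0 < G) {g : ℕ → Vec d}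
    (hg : ∀ i, ‖g i‖ ≤ G) {T : ℕ} (u : ℕ → Vec d) (b : ℕ) {n : ℕ} (hnT : n ≤ T)
    (hnb : n ≤ 2 ^ (b + 1) - 2) :
    linearRegret (anytimeHaarOLR G) g n (fun i => u (i + 1)) ≤ b * blockRegretBound G T u := by
  induction b generalizing n with
  | zero =>
    obtain rfl : n = 0 := Nat.le_zero.1 hnb
    simp [linearRegret]
  | succ b ih =>
    rw [Nat.cast_succ, add_one_mul]
    rcases le_or_gt n (2 ^ (b + 1) - 2) with hle | hlt
    · have hbound : 0 ≤ blockRegretBound G T u := by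
        have hrate := switchingRate_nonneg T u
        unfold blockRegretBound
        positivity
      exact (ih hnT hle).trans (le_add_of_nonneg_right hbound)
    · obtain ⟨k, rfl⟩ := Nat.exists_eq_add_of_le hlt.le
      rw [pow_succ 2 (b + 1)] at hnb
      rw [linearRegret_anytimeHaarOLR_add G g _ b.succ_ne_zero (by omega)]
      exact add_le_add (ih (by omega) le_rfl)
        (linearRegret_haarOLR_block_le hG (fun _ => hg _) (by omega) (by omega) hnT u)

theorem linearRegret_anytimeHaarOLR_le {G : ℝ} (hG : 0 < G) {g : ℕ → Vec d} (hg : ∀ i, ‖g i‖ ≤ G)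
    {T : ℕ} (hT : 1 ≤ T) (u : ℕ → Vec d) :
    linearRegret (anytimeHaarOLR G) g T (fun i => u (i + 1)) ≤
      200 * G * Real.log (T + 1) + 200 * G * switchingRate T u * logFactor T u ^ 3 := by
  set b := Nat.log 2 (T + 1)
  have hb : 2 ^ b ≤ T + 1 := Nat.pow_log_le_self 2 T.succ_ne_zero
  have hTb : T + 1 < 2 ^ (b + 1) := Nat.lt_pow_succ_log_self one_lt_two _
  have hblog : (b : ℝ) ≤ 2 * Real.log (T + 1) := natCast_le_two_mul_log (by exact_mod_cast hb)
  have hbfactor : (b : ℝ) ≤ 2 * logFactor T u := natCast_le_two_mul_logFactor (by omega) u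
  have hrate := switchingRate_nonneg T u
  have hlog : 0 ≤ Real.log ((T : ℝ) + 1) := by exact_mod_cast Real.log_natCast_nonneg (T + 1)
  calc linearRegret (anytimeHaarOLR G) g T (fun i => u (i + 1))
      ≤ b * blockRegretBound G T u :=
        linearRegret_anytimeHaarOLR_le_mul hG hg u b le_rfl (by omega)
    _ = b * G + b * (100 * G * logFactor T u ^ 2 * switchingRate T u) := mul_add _ _ _
    _ ≤ 2 * Real.log (T + 1) * G +
          2 * logFactor T u * (100 * G * logFactor T u ^ 2 * switchingRate T u) := by gcongr
    _ = 2 * G * Real.log (T + 1) + 200 * G * switchingRate T u * logFactor T u ^ 3 := by ring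
    _ ≤ 200 * G * Real.log (T + 1) + 200 * G * switchingRate T u * logFactor T u ^ 3 := by
        gcongr
        norm_num

end Anytime

end

theorem theorem2 :
    ∃ (C : ℝ) (k : ℕ), ∀ (d : ℕ) (G : NNReal), 0 < G →
      ∀ (T : ℕ), 1 ≤ T → ∀ (u : ℕ → Vec d),
        dynamicRegret (anytimeHaarOLR (d := d) (G : ℝ)) G T u ≤
          ((C * G * Real.log (T + 1)
            + C * G * (‖comparatorAverage T u‖ * √(T : ℝ)
                + √((numSwitches T u : ℝ) * secondOrderVariability T u))
              * (1 + Real.log T + Real.log (1 + maxRange T u)) ^ k : ℝ) : EReal) :=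
  ⟨200, 3, fun _ _ hG _ hT u => iSup_le fun env => EReal.coe_le_coe_iff.2 <|
    (sum_roundLoss_sub_le_linearRegret _ env _ u).trans <|
      linearRegret_anytimeHaarOLR_le (NNReal.coe_pos.2 hG) (fun _ => env.norm_grad_le _ _) hT u⟩
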